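/- Let $M_n$ be the algebra of complex $n\times n$ matrices. An operator system in $M_n$ is a linear subspace $V\subseteq M_n$ with $\mathbb 1\in V$ and $V=V^*$; it is also regarded as a quantum graph on $M_n$. The automorphism group of the quantum graph $V$ is the group of all $*$-automorphisms $\Phi$ of $M_n$ with $\Phi(V)=V$. The automorphism group of the operator system $V$ is the group of all unital complete order isomorphisms of $V$ onto itself, that is, of all linear bijections $\varphi:V\to V$ with $\varphi(\mathbb 1)=\mathbb 1$ such that $\varphi$ and $\varphi^{-1}$ are completely positive (for every $k$ the entrywise amplification to $M_k(V)\subseteq M_{kn}$ maps positive semidefinite elements to positive semidefinite elements). Fix $n\ge 3$ and $2\le d\le n^2-3$, and let $X_1,\dots,X_d$ be independent random matrices, each distributed as the traceless GUE, i.e. as $Y-\frac{\operatorname{Tr}Y}{n}\mathbb 1$, where $Y$ is a random self-adjoint $n\times n$ matrix with density proportional to $e^{-\operatorname{Tr}Y^2}$. Let $V_d=\operatorname{span}(\mathbb 1,X_1,\dots,X_d)$; this random operator system is the model $QG(n,d)$. If the automorphism group of the quantum graph $V_d$ is almost surely trivial, then the automorphism group of the operator system $V_d$ is almost surely trivial: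 almost surely, the only unital complete order isomorphism of $V_d$ onto itself is the identity. -/

import Mathlib

open MeasureTheory ProbabilityTheory
open scoped ComplexOrder

/-- An operator system in `M_n`: a self-adjoint linear subspace containing the identity.
Equivalently, a (reflexive, undirected) quantum graph on `M_n`. -/
structure OperatorSystem (n : ℕ) where
  /-- The underlying subspace of `M_n`. -/
  carrier : Submodule ℂ (Matrix (Fin n) (Fin n) ℂ)
  one_mem : (1 : Matrix (Fin n) (Fin n) ℂ) ∈ carrier
  star_mem : ∀ A ∈ carrier, star A ∈ carrier

namespace OperatorSystem

variable {n m : ℕ}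

/-- The unit of the operator system, as an element of it. -/
def unit (V : OperatorSystem n) : V.carrier := ⟨1, V.one_mem⟩

/-- The automorphism group of the quantum graph `V ⊆ M_n`: the `*`-automorphisms `Φ` of `M_n`
such that `Φ(V) = V`. -/
def quantumGraphAut (V : OperatorSystem n) :
    Subgroup (Matrix (Fin n) (Fin n) ℂ ≃⋆ₐ[ℂ] Matrix (Fin n) (Fin n) ℂ) where
  carrier := {Φ | Φ '' (V.carrier : Set (Matrix (Fin n) (Fin n) ℂ)) = V.carrier}
  one_mem' := by
    change (fun x => x) '' (V.carrier : Set (Matrix (Fin n) (Fin n) ℂ)) = V.carrier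
    exact Set.image_id' _
  mul_mem' := by
    intro Φ Ψ hΦ hΨ
    change (fun x => Φ (Ψ x)) '' (V.carrier : Set (Matrix (Fin n) (Fin n) ℂ)) = V.carrier
    rw [← Set.image_image Φ Ψ, hΨ, hΦ]
  inv_mem' := by
    intro Φ hΦ
    have h : Φ '' (V.carrier : Set (Matrix (Fin n) (Fin n) ℂ)) = V.carrier := hΦ
    change Φ.symm '' (V.carrier : Set (Matrix (Fin n) (Fin n) ℂ)) = V.carrier
    conv_lhs => rw [← h]
    rw [Set.image_image]
    simp

/-- An element of `M_k(V)` is positive if it is positive semidefinite as a block matrix, that is,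
as an element of `M_k(M_n) = M_{kn}`. -/
def MatrixPositive (V : OperatorSystem n) {k : ℕ} (A : Matrix (Fin k) (Fin k) V.carrier) : Prop :=
  (Matrix.comp (Fin k) (Fin k) (Fin n) (Fin n) ℂ
    (A.map (fun v => (v : Matrix (Fin n) (Fin n) ℂ)))).PosSemidef

/-- A linear map between operator systems is completely positive if all its entrywise
amplifications `M_k(V) → M_k(W)` preserve positivity. -/
def IsCompletelyPositive {V : OperatorSystem n} {W : OperatorSystem m}
    (φ : V.carrier →ₗ[ℂ] W.carrier) : Prop :=
  ∀ (k : ℕ) (A : Matrix (Fin k) (Fin k) V.carrier),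
    V.MatrixPositive A → W.MatrixPositive (A.map φ)

/-- A unital complete order isomorphism: a unital linear bijection that is completely positive
together with its inverse. -/
structure IsUnitalCompleteOrderIso {V : OperatorSystem n} {W : OperatorSystem m}
    (φ : V.carrier ≃ₗ[ℂ] W.carrier) : Prop where
  map_unit : φ V.unit = W.unit
  completelyPositive : IsCompletelyPositive φ.toLinearMap
  completelyPositive_symm : IsCompletelyPositive φ.symm.toLinearMap

/-- The automorphism group of the operator system `V`, regardless of its embedding in `M_n`: the
unital complete order isomorphisms of `V` onto itself. -/
def unitalCompleteOrderAut (V : OperatorSystem n) : Subgroup (V.carrier ≃ₗ[ℂ] V.carrier) where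
  carrier := {φ | IsUnitalCompleteOrderIso φ}
  one_mem' := ⟨rfl, fun _ _ hA => hA, fun _ _ hA => hA⟩
  mul_mem' := by
    intro φ ψ hφ hψ
    refine ⟨?_, fun k A hA => ?_, fun k A hA => ?_⟩
    · change φ (ψ V.unit) = V.unit
      rw [hψ.map_unit, hφ.map_unit]
    · exact hφ.completelyPositive k _ (hψ.completelyPositive k A hA)
    · exact hψ.completelyPositive_symm k _ (hφ.completelyPositive_symm k A hA)
  inv_mem' := by
    intro φ hφ
    refine ⟨?_, hφ.completelyPositive_symm, hφ.completelyPositive⟩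
    change φ.symm V.unit = V.unit
    rw [LinearEquiv.symm_apply_eq, hφ.map_unit]

/-- The operator system `span(1, X_1, …, X_d)` generated by self-adjoint matrices. -/
def ofTuple {d : ℕ} (X : Fin d → selfAdjoint (Matrix (Fin n) (Fin n) ℂ)) : OperatorSystem n where
  carrier := Submodule.span ℂ
    (insert 1 (Set.range fun i => (X i : Matrix (Fin n) (Fin n) ℂ)))
  one_mem := Submodule.subset_span (Set.mem_insert _ _)
  star_mem := by
    intro A hA
    induction hA using Submodule.span_induction with
    | mem x hx =>
      refine Submodule.subset_span ?_
      rcases hx with rfl | ⟨i, rfl⟩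
      · rw [star_one]
        exact Set.mem_insert _ _
      · rw [(X i).2.star_eq]
        exact Set.mem_insert_of_mem _ ⟨i, rfl⟩
    | zero => simp
    | add x y _ _ hx hy =>
      rw [star_add]
      exact Submodule.add_mem _ hx hy
    | smul c x _ hx =>
      rw [star_smul]
      exact Submodule.smul_mem _ _ hx

end OperatorSystem

/-- The `σ`-algebra on complex matrices generated by the entries (the Borel `σ`-algebra). -/
noncomputable instance instMeasurableSpaceComplexMatrix (n : ℕ) :
    MeasurableSpace (Matrix (Fin n) (Fin n) ℂ) :=
  inferInstanceAs (MeasurableSpace (Fin n → Fin n → ℂ))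

noncomputable section

/-- The self-adjoint matrix with diagonal entries `g i i / √2`, and entries
`(g i j + 𝐢 g j i) / 2` for `i < j` above the diagonal. -/
def hermitianOfReal {n : ℕ} (g : Fin n → Fin n → ℝ) : selfAdjoint (Matrix (Fin n) (Fin n) ℂ) :=
  ⟨Matrix.of fun i j =>
      if i = j then ((g i i / √2 : ℝ) : ℂ)
      else if i < j then ((g i j : ℂ) + Complex.I * (g j i : ℂ)) / 2
      else ((g j i : ℂ) - Complex.I * (g i j : ℂ)) / 2, by
    rw [selfAdjoint.mem_iff]
    ext i j
    rcases lt_trichotomy i j with h | h | h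
    · simp [Matrix.star_apply, h.ne, h.ne', h, h.not_gt, sub_eq_add_neg]
    · subst h
      simp [Matrix.star_apply]
    · simp [Matrix.star_apply, h.ne, h.ne', h, h.not_gt, sub_eq_add_neg]⟩

/-- The Gaussian unitary ensemble, as a law on the self-adjoint `n × n` matrices. With independent
standard normal variables `g i j` the diagonal entries of `hermitianOfReal g` have variance `1/2`,
and the real and imaginary parts of the entries above the diagonal have variance `1/4`, all of them
independent: the density is proportional to `exp (-Tr X²)`. -/
def gue (n : ℕ) : Measure (selfAdjoint (Matrix (Fin n) (Fin n) ℂ)) :=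
  (Measure.pi fun _ : Fin n => Measure.pi fun _ : Fin n => gaussianReal 0 1).map hermitianOfReal

/-- The traceless part `X - (Tr X / n) 1` of a self-adjoint matrix. -/
def tracelessPart {n : ℕ} (X : selfAdjoint (Matrix (Fin n) (Fin n) ℂ)) :
    selfAdjoint (Matrix (Fin n) (Fin n) ℂ) :=
  ⟨X.1 - (X.1.trace / n) • (1 : Matrix (Fin n) (Fin n) ℂ), by
    have h : star X.1 = X.1 := X.2
    have ht : star X.1.trace = X.1.trace := by
      rw [← Matrix.trace_conjTranspose, ← Matrix.star_eq_conjTranspose, h]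
    rw [selfAdjoint.mem_iff, star_sub, star_smul, star_one, h, star_div₀, ht, star_natCast]⟩

/-- The traceless (centered) Gaussian unitary ensemble. -/
def tracelessGUE (n : ℕ) : Measure (selfAdjoint (Matrix (Fin n) (Fin n) ℂ)) :=
  (gue n).map tracelessPart

theorem measurable_hermitianOfReal (n : ℕ) : Measurable (hermitianOfReal (n := n)) := by
  refine Measurable.subtype_mk ?_
  refine measurable_pi_iff.2 fun i => measurable_pi_iff.2 fun j => ?_
  simp only [Matrix.of_apply]
  split_ifs <;> fun_prop

theorem measurable_tracelessPart (n : ℕ) : Measurable (tracelessPart (n := n)) := by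
  have hc : ∀ i j : Fin n,
      Measurable fun X : selfAdjoint (Matrix (Fin n) (Fin n) ℂ) => X.1 i j := fun i j =>
    (measurable_pi_iff.1 (measurable_pi_iff.1
      (measurable_subtype_coe : Measurable
        fun X : selfAdjoint (Matrix (Fin n) (Fin n) ℂ) => X.1) i) j)
  refine Measurable.subtype_mk ?_
  refine measurable_pi_iff.2 fun i => measurable_pi_iff.2 fun j => ?_
  simp only [Matrix.sub_apply, Matrix.smul_apply, Matrix.trace, Matrix.diag_apply]
  refine (hc i j).sub (Measurable.smul_const ?_ _)
  exact (Finset.measurable_sum _ fun k _ => hc k k).div_const _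

instance instIsProbabilityMeasureTracelessGUE (n : ℕ) :
    IsProbabilityMeasure (tracelessGUE n) := by
  have : IsProbabilityMeasure (gue n) :=
    Measure.isProbabilityMeasure_map (measurable_hermitianOfReal n).aemeasurable
  exact Measure.isProbabilityMeasure_map (measurable_tracelessPart n).aemeasurable

end

/-!
# Automorphisms of generic operator systems are quantum graph automorphisms

Almost surely `V = span (1, X_1, …, X_d)` generates `M_n` as an algebra, and for such `V` every
unital complete order automorphism `φ` is the restriction of the conjugation by a unitary. This
conjugation is an automorphism of the quantum graph `V`, so it is trivial as soon as the latter
group is, and then so is `φ`.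

*Extension.* By Krein's extension theorem for positive functionals
(`exists_posSemidef_extension`), applied to the functional on `M_n(V)` which encodes `φ`, and Choi's
theorem, `φ` and `φ⁻¹` extend to maps `x ↦ ∑ k, (K k)ᴴ * x * K k` of `M_n`
(`OperatorSystem.IsCompletelyPositive.exists_krausMap`).

*Rigidity.* Fix such an extension `K` of `φ`. The compositions `L ∘ K` which are the identity on
`V`, with `L` unital and completely positive, form a nonempty compact semigroup, which contains an
idempotent `E` by the Ellis–Numakura lemma. If `E y = y`, then `E (yᴴ * y) - yᴴ * y` is the sum of
the squares of the commutators of `y` with the Kraus operators of `E`, and `E` kills it. This makes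
the kernel of `E` stable under right multiplication by `y`, hence by the algebra `M_n` that `V`
generates, and, by taking adjoints, a two-sided ideal. As `M_n` is simple and `E` is unital, `E` is injective, so `E` is the
identity (`krausMap_eq_self_of_idempotent`). Thus `L ∘ K` is the identity; its Kraus operators are
then central, and all Kraus operators of `K` are multiples of one unitary
(`exists_unitary_of_krausMap_leftInverse`).

*Genericity.* If `A` is diagonal with distinct eigenvalues and no entry of `B` vanishes, then the
`n ^ 2` words `A ^ i * B * A ^ j` form a basis of `M_n`. Hence the determinant of the matrix of
words is a nonzero polynomial in the Gaussian coordinates of the pair `(X_1, X_2)`, and its zero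
set is null: it meets every line through a point where it does not vanish in a finite set
(`measure_eq_zero_of_forall_line`).
-/

/-! ### Idempotent and invertible Kraus maps -/

section Kraus

open scoped Matrix

variable {n : ℕ} {κ : Type*} [Fintype κ]

/-- The completely positive map `x ↦ ∑ k, (K k)ᴴ * x * K k` of `M_n` with Kraus operators `K`. -/
noncomputable def krausMap (K : κ → Matrix (Fin n) (Fin n) ℂ) :
    Matrix (Fin n) (Fin n) ℂ →ₗ[ℂ] Matrix (Fin n) (Fin n) ℂ where
  toFun x := ∑ k, (K k)ᴴ * x * K k
  map_add' x y := by simp [mul_add, add_mul, Finset.sum_add_distrib]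
  map_smul' c x := by simp [Finset.smul_sum]

theorem krausMap_apply (K : κ → Matrix (Fin n) (Fin n) ℂ) (x : Matrix (Fin n) (Fin n) ℂ) :
    krausMap K x = ∑ k, (K k)ᴴ * x * K k := rfl

theorem krausMap_conjTranspose (K : κ → Matrix (Fin n) (Fin n) ℂ)
    (x : Matrix (Fin n) (Fin n) ℂ) : krausMap K xᴴ = (krausMap K x)ᴴ := by
  simp [krausMap_apply, Matrix.conjTranspose_sum, Matrix.mul_assoc]

theorem krausMap_comp {ι : Type*} [Fintype ι] (L : ι → Matrix (Fin n) (Fin n) ℂ)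
    (K : κ → Matrix (Fin n) (Fin n) ℂ) (x : Matrix (Fin n) (Fin n) ℂ) :
    krausMap L (krausMap K x) = krausMap (fun p : κ × ι => K p.1 * L p.2) x := by
  simp only [krausMap_apply, Fintype.sum_prod_type_right, Finset.mul_sum, Finset.sum_mul,
    Matrix.conjTranspose_mul, Matrix.mul_assoc]

theorem eq_zero_of_sum_conjTranspose_mul_self_eq_zero {A : κ → Matrix (Fin n) (Fin n) ℂ}
    (h : ∑ k, (A k)ᴴ * A k = 0) (k : κ) : A k = 0 := by
  have ht : ∑ k, ((A k)ᴴ * A k).trace = 0 := by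
    rw [← Matrix.trace_sum, h, Matrix.trace_zero]
  rw [Finset.sum_eq_zero_iff_of_nonneg fun k _ =>
    (Matrix.posSemidef_conjTranspose_mul_self (A k)).trace_nonneg] at ht
  exact Matrix.trace_conjTranspose_mul_self_eq_zero_iff.1 (ht k (Finset.mem_univ k))

/-- The defect in the Schwarz inequality for a unital Kraus map, at a fixed point, is the sum of
the squares of the commutators with the Kraus operators. -/
theorem sum_commutator_eq_krausMap_sub {K : κ → Matrix (Fin n) (Fin n) ℂ}
    (hK : krausMap K 1 = 1) {y : Matrix (Fin n) (Fin n) ℂ} (hy : krausMap K y = y) :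
    ∑ k, (y * K k - K k * y)ᴴ * (y * K k - K k * y) = krausMap K (yᴴ * y) - yᴴ * y := by
  have hy' : krausMap K yᴴ = yᴴ := by rw [krausMap_conjTranspose, hy]
  have h : ∀ k, (y * K k - K k * y)ᴴ * (y * K k - K k * y) =
      (K k)ᴴ * (yᴴ * y) * K k - ((K k)ᴴ * yᴴ * K k) * y - yᴴ * ((K k)ᴴ * y * K k)
        + yᴴ * ((K k)ᴴ * 1 * K k) * y := by
    intro k
    simp only [Matrix.conjTranspose_sub, Matrix.conjTranspose_mul]
    noncomm_ring
  simp only [h, Finset.sum_add_distrib, Finset.sum_sub_distrib, ← Finset.sum_mul,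
    ← Finset.mul_sum, ← krausMap_apply, hK, hy, hy']
  noncomm_ring

/-- The kernel of an idempotent unital Kraus map is stable under right multiplication by fixed
points `y`: the map kills the Schwarz defect at `y`, so the commutators of `y` with the Kraus
operators vanish on the ranges of the Kraus operators. -/
theorem krausMap_mul_eq_zero_of_idempotent {C : κ → Matrix (Fin n) (Fin n) ℂ}
    (hC : krausMap C 1 = 1) (hidem : ∀ x, krausMap C (krausMap C x) = krausMap C x)
    {y : Matrix (Fin n) (Fin n) ℂ} (hy : krausMap C y = y)
    {x : Matrix (Fin n) (Fin n) ℂ} (hx : krausMap C x = 0) : krausMap C (x * y) = 0 := by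
  have hzero : ∀ p : κ × κ, (y * C p.1 - C p.1 * y) * C p.2 = 0 := by
    refine eq_zero_of_sum_conjTranspose_mul_self_eq_zero ?_
    have h := congrArg (krausMap C) (sum_commutator_eq_krausMap_sub hC hy)
    rw [map_sub, hidem, sub_self] at h
    rw [← h, krausMap_apply, Fintype.sum_prod_type_right]
    simp only [Finset.mul_sum, Finset.sum_mul, Matrix.conjTranspose_mul, Matrix.mul_assoc]
  have h1 : krausMap C (x * y) = ∑ k, (C k)ᴴ * x * (y * C k - C k * y) := by
    have : ∀ k, (C k)ᴴ * x * (y * C k - C k * y) =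
        (C k)ᴴ * (x * y) * C k - ((C k)ᴴ * x * C k) * y := fun k => by noncomm_ring
    simp only [this, Finset.sum_sub_distrib, ← Finset.sum_mul, ← krausMap_apply, hx]
    simp
  rw [← hidem, h1, krausMap_apply]
  refine Finset.sum_eq_zero fun l _ => ?_
  rw [Finset.mul_sum, Finset.sum_mul]
  refine Finset.sum_eq_zero fun k _ => ?_
  rw [Matrix.mul_assoc, Matrix.mul_assoc, hzero (k, l), mul_zero, mul_zero]

/-- An idempotent unital completely positive map of `M_n` that fixes a generating set
is the identity: its kernel is a two-sided ideal of the simple algebra `M_n`. -/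
theorem krausMap_eq_self_of_idempotent {C : κ → Matrix (Fin n) (Fin n) ℂ}
    (hC : krausMap C 1 = 1) (hidem : ∀ x, krausMap C (krausMap C x) = krausMap C x)
    {V : Set (Matrix (Fin n) (Fin n) ℂ)}
    (hgen : Algebra.adjoin ℂ V = ⊤) (hfix : ∀ y ∈ V, krausMap C y = y)
    (x : Matrix (Fin n) (Fin n) ℂ) : krausMap C x = x := by
  have hright : ∀ y x, krausMap C x = 0 → krausMap C (x * y) = 0 := by
    intro y
    have hy : y ∈ Algebra.adjoin ℂ V := by rw [hgen]; trivial
    induction hy using Algebra.adjoin_induction with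
    | mem y hy => exact fun x hx => krausMap_mul_eq_zero_of_idempotent hC hidem (hfix y hy) hx
    | algebraMap r =>
      intro x hx
      rw [← Algebra.commutes, ← Algebra.smul_def, map_smul, hx, smul_zero]
    | add y z _ _ hy hz => intro x hx; rw [mul_add, map_add, hy x hx, hz x hx, add_zero]
    | mul y z _ _ hy hz => intro x hx; rw [← mul_assoc]; exact hz _ (hy x hx)
  have hleft : ∀ y x, krausMap C x = 0 → krausMap C (y * x) = 0 := by
    intro y x hx
    rw [← Matrix.conjTranspose_conjTranspose (y * x), krausMap_conjTranspose,
      Matrix.conjTranspose_mul, hright, Matrix.conjTranspose_zero]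
    rw [krausMap_conjTranspose, hx, Matrix.conjTranspose_zero]
  have hker : ∀ z, krausMap C z = 0 → z = 0 := by
    intro z hz
    ext a b
    by_contra hab
    rw [Matrix.zero_apply] at hab
    have hsingle : ∀ i : Fin n, krausMap C (Matrix.single i i (z a b)) = 0 := by
      intro i
      have := hright (Matrix.single b i 1) _ (hleft (Matrix.single i a 1) z hz)
      rwa [Matrix.single_mul_mul_single, one_mul, mul_one] at this
    have hone : krausMap C (z a b • 1) = 0 := by
      have hsum : z a b • (1 : Matrix (Fin n) (Fin n) ℂ) =
          ∑ i, Matrix.single i i (z a b) := by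
        rw [Matrix.sum_single_eq_diagonal, Matrix.smul_one_eq_diagonal]
      rw [hsum, map_sum, Finset.sum_eq_zero fun i _ => hsingle i]
    rw [map_smul, hC] at hone
    have := congrFun (congrFun hone a) a
    simp [hab] at this
  exact (sub_eq_zero.1 (hker _ (by rw [map_sub, hidem, sub_self]))).symm

/-- If a composition of two unital Kraus maps is the identity, the first of them is the
conjugation by a unitary: all products of Kraus operators are scalars. -/
theorem exists_unitary_of_krausMap_leftInverse [NeZero n] {ι : Type*} [Fintype ι]
    {K : κ → Matrix (Fin n) (Fin n) ℂ} {L : ι → Matrix (Fin n) (Fin n) ℂ}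
    (hK : krausMap K 1 = 1) (hLK : ∀ x, krausMap L (krausMap K x) = x) :
    ∃ U ∈ unitary (Matrix (Fin n) (Fin n) ℂ), ∀ x, krausMap K x = star U * x * U := by
  simp only [krausMap_comp] at hLK
  -- Every matrix is a fixed point of the composition, so its Kraus operators are central.
  have hcomm : ∀ y, ∀ p : κ × ι, y * (K p.1 * L p.2) - K p.1 * L p.2 * y = 0 := by
    intro y
    refine eq_zero_of_sum_conjTranspose_mul_self_eq_zero ?_
    rw [sum_commutator_eq_krausMap_sub (hLK 1) (hLK y), hLK, sub_self]
  have hscalar : ∀ k l, ∃ c : ℂ, K k * L l = c • 1 := by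
    intro k l
    obtain ⟨c, hc⟩ := Matrix.mem_range_scalar_iff_commute_single.2
      (fun i j _ => sub_eq_zero.1 (hcomm (Matrix.single i j 1) (k, l)))
    exact ⟨c, by rw [← hc, Matrix.scalar_apply, Matrix.smul_one_eq_diagonal]⟩
  choose c hc using hscalar
  obtain ⟨k₀, l₀, h₀⟩ : ∃ k l, c k l ≠ 0 := by
    by_contra! h
    have h1 := hLK 1
    simp [krausMap_apply, hc, h] at h1
  have hinv : L l₀ * K k₀ = c k₀ l₀ • 1 := by
    have h1 : K k₀ * ((c k₀ l₀)⁻¹ • L l₀) = 1 := by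
      rw [mul_smul_comm, hc, smul_smul, inv_mul_cancel₀ h₀, one_smul]
    have h2 := mul_eq_one_comm.1 h1
    rw [smul_mul_assoc, inv_smul_eq_iff₀ h₀] at h2
    exact h2
  have hprop : ∀ k, K k = (c k l₀ / c k₀ l₀) • K k₀ := by
    intro k
    have h1 : K k * (L l₀ * K k₀) = c k l₀ • K k₀ := by
      rw [← mul_assoc, hc, smul_mul_assoc, one_mul]
    rw [hinv, mul_smul_comm, mul_one] at h1
    rw [div_eq_inv_mul, mul_smul, ← h1, smul_smul, inv_mul_cancel₀ h₀, one_smul]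
  set r : ℝ := ∑ k, ‖c k l₀ / c k₀ l₀‖ ^ 2 with hr
  have hr0 : 0 ≤ r := Finset.sum_nonneg fun k _ => sq_nonneg _
  have hKx : ∀ x, krausMap K x =
      star ((√r : ℂ) • K k₀) * x * ((√r : ℂ) • K k₀) := by
    intro x
    have hterm : ∀ k, (K k)ᴴ * x * K k =
        (((‖c k l₀ / c k₀ l₀‖ ^ 2 : ℝ) : ℂ)) • ((K k₀)ᴴ * x * K k₀) := by
      intro k
      rw [hprop k, Matrix.conjTranspose_smul, smul_mul_assoc, smul_mul_assoc, mul_smul_comm,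
        smul_smul]
      congr 1
      rw [Complex.ofReal_pow, ← Complex.conj_mul']
      rfl
    rw [krausMap_apply, Finset.sum_congr rfl fun k _ => hterm k, ← Finset.sum_smul,
      ← Complex.ofReal_sum, ← hr, Matrix.star_eq_conjTranspose, Matrix.conjTranspose_smul,
      smul_mul_assoc, smul_mul_assoc, mul_smul_comm, smul_smul]
    congr 1
    rw [Complex.star_def, Complex.conj_ofReal, ← Complex.ofReal_mul, Real.mul_self_sqrt hr0]
  refine ⟨(√r : ℂ) • K k₀, ?_, hKx⟩
  have h1 := hKx 1
  rw [hK, mul_one] at h1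
  exact Unitary.mem_iff.2 ⟨h1.symm, mul_eq_one_comm.1 h1.symm⟩

end Kraus

/-! ### Choi matrices and compactness of the set of unital Kraus maps -/

section Compactness

open scoped Matrix

variable {n : ℕ} {κ : Type*} [Fintype κ]

/-- The Choi matrix of a Kraus map, with rows and columns paired as `(output, input)`. -/
noncomputable def choiOfKraus (K : κ → Matrix (Fin n) (Fin n) ℂ) :
    Matrix (Fin n × Fin n) (Fin n × Fin n) ℂ :=
  Matrix.of fun p q => ∑ k, star (K k p.2 p.1) * K k q.2 q.1

theorem krausMap_apply_apply (K : κ → Matrix (Fin n) (Fin n) ℂ) (x : Matrix (Fin n) (Fin n) ℂ)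
    (i j : Fin n) :
    krausMap K x i j = ∑ a, ∑ b, x a b * choiOfKraus K (i, a) (j, b) := by
  simp only [krausMap_apply, Matrix.sum_apply, Matrix.mul_apply, Matrix.conjTranspose_apply,
    choiOfKraus, Matrix.of_apply, Finset.mul_sum, Finset.sum_mul]
  rw [Finset.sum_comm, Finset.sum_comm_cycle]
  refine Finset.sum_congr rfl fun a _ => Finset.sum_congr rfl fun b _ =>
    Finset.sum_congr rfl fun k _ => ?_
  ring

theorem posSemidef_choiOfKraus (K : κ → Matrix (Fin n) (Fin n) ℂ) :
    (choiOfKraus K).PosSemidef := by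
  have : choiOfKraus K = ∑ k, Matrix.vecMulVec (star fun p : Fin n × Fin n => K k p.2 p.1)
      (fun p : Fin n × Fin n => K k p.2 p.1) := by
    ext p q
    simp [choiOfKraus, Matrix.sum_apply, Matrix.vecMulVec_apply]
  rw [this]
  exact Matrix.posSemidef_sum _ fun k _ => Matrix.posSemidef_vecMulVec_star_self _

/-- Choi's theorem: a positive semidefinite matrix on `Fin n × Fin n` is the Choi matrix of a
Kraus map with `n ^ 2` Kraus operators. -/
theorem exists_choiOfKraus_eq {C : Matrix (Fin n × Fin n) (Fin n × Fin n) ℂ}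
    (hC : C.PosSemidef) :
    ∃ K : Fin n × Fin n → Matrix (Fin n) (Fin n) ℂ, choiOfKraus K = C := by
  obtain ⟨B, rfl⟩ : ∃ B : Matrix (Fin n × Fin n) (Fin n × Fin n) ℂ, C = star B * B := by
    open scoped Matrix.Norms.L2Operator MatrixOrder in
    exact CStarAlgebra.nonneg_iff_eq_star_mul_self.1 (Matrix.nonneg_iff_posSemidef.2 hC)
  refine ⟨fun k => Matrix.of fun b j => B k (j, b), ?_⟩
  ext p q
  simp [choiOfKraus, Matrix.mul_apply, Matrix.star_apply]

/-- The number of Kraus operators can always be reduced to `n ^ 2`. -/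
theorem exists_krausMap_eq (K : κ → Matrix (Fin n) (Fin n) ℂ) :
    ∃ K' : Fin n × Fin n → Matrix (Fin n) (Fin n) ℂ, krausMap K' = krausMap K := by
  obtain ⟨K', hK'⟩ := exists_choiOfKraus_eq (posSemidef_choiOfKraus K)
  refine ⟨K', LinearMap.ext fun x => ?_⟩
  ext i j
  simp only [krausMap_apply_apply, hK']

theorem norm_apply_le_one_of_krausMap_one {L : κ → Matrix (Fin n) (Fin n) ℂ}
    (hL : krausMap L 1 = 1) (k : κ) (a i : Fin n) : ‖L k a i‖ ≤ 1 := by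
  have h := congrFun (congrFun hL i) i
  simp only [krausMap_apply, mul_one, Matrix.sum_apply, Matrix.mul_apply,
    Matrix.conjTranspose_apply, Matrix.one_apply_eq, Complex.star_def, Complex.conj_mul'] at h
  have h' : ∑ k, ∑ a, ‖L k a i‖ ^ 2 = 1 := by exact_mod_cast h
  rw [← sq_le_one_iff₀ (norm_nonneg _), ← h']
  exact (Finset.single_le_sum (f := fun a => ‖L k a i‖ ^ 2) (fun _ _ => sq_nonneg _)
    (Finset.mem_univ a)).trans (Finset.single_le_sum (f := fun k => ∑ a, ‖L k a i‖ ^ 2)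
      (fun _ _ => Finset.sum_nonneg fun _ _ => sq_nonneg _) (Finset.mem_univ k))

theorem isCompact_setOf_krausMap_one : IsCompact
    {L : κ → Matrix (Fin n) (Fin n) ℂ | krausMap L 1 = 1} := by
  have hcpt : IsCompact (Set.univ.pi fun _ : κ => Set.univ.pi fun _ : Fin n => Set.univ.pi
      fun _ : Fin n => Metric.closedBall (0 : ℂ) 1) :=
    isCompact_univ_pi fun _ => isCompact_univ_pi fun _ => isCompact_univ_pi fun _ =>
      isCompact_closedBall 0 1
  refine hcpt.of_isClosed_subset (isClosed_eq ?_ continuous_const) fun L hL k _ a _ i _ => ?_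
  · simp only [krausMap_apply]
    fun_prop
  · exact mem_closedBall_zero_iff.2 (norm_apply_le_one_of_krausMap_one hL k a i)

/-- A form of Arveson's boundary theorem. The compositions `krausMap L ∘ krausMap K` that are unital
and fix `V` form a compact semigroup, and an idempotent in it is the identity. -/
theorem exists_krausMap_leftInverse {K L : Fin n × Fin n → Matrix (Fin n) (Fin n) ℂ}
    (hK : krausMap K 1 = 1) (hL : krausMap L 1 = 1) {V : Set (Matrix (Fin n) (Fin n) ℂ)}
    (hgen : Algebra.adjoin ℂ V = ⊤) (hLK : ∀ y ∈ V, krausMap L (krausMap K y) = y) :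
    ∃ L' : Fin n × Fin n → Matrix (Fin n) (Fin n) ℂ, ∀ x, krausMap L' (krausMap K x) = x := by
  let A := Matrix (Fin n) (Fin n) ℂ
  let S : Set (Fin n × Fin n → A) :=
    {L | krausMap L 1 = 1 ∧ ∀ y ∈ V, krausMap L (krausMap K y) = y}
  have hS : IsCompact S := by
    refine isCompact_setOf_krausMap_one.inter_right (t := {L : Fin n × Fin n → A |
      ∀ y ∈ V, krausMap L (krausMap K y) = y}) ?_
    simp only [Set.ofPred_forall]
    refine isClosed_biInter fun y _ => isClosed_eq ?_ continuous_const
    simp only [krausMap_apply]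
    fun_prop
  -- In the topology of pointwise convergence `f ↦ f ∘ r` is continuous, as the Ellis–Numakura
  -- lemma requires.
  let : TopologicalSpace (Function.End A) := (Pi.topologicalSpace : TopologicalSpace (A → A))
  have : T2Space (Function.End A) := (inferInstance : T2Space (A → A))
  let F : (Fin n × Fin n → A) → Function.End A := fun L x => krausMap L (krausMap K x)
  have hF : Continuous F := by
    refine continuous_pi fun x => ?_
    simp only [F, krausMap_apply]
    fun_prop
  obtain ⟨_, ⟨L', hL', rfl⟩, hidem⟩ := exists_idempotent_in_compact_subsemigroup
    (M := Function.End A)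
    (fun r => continuous_pi fun x => continuous_apply (r x)) (F '' S)
    (Set.Nonempty.image F ⟨L, hL, hLK⟩) (hS.image hF) (by
      rintro _ ⟨L₁, h₁, rfl⟩ _ ⟨L₂, h₂, rfl⟩
      obtain ⟨L₃, h₃⟩ := exists_krausMap_eq
        fun p : ((Fin n × Fin n) × (Fin n × Fin n)) × (Fin n × Fin n) =>
          L₂ p.1.1 * K p.1.2 * L₁ p.2
      have h₃' : ∀ x, krausMap L₃ x = krausMap L₁ (krausMap K (krausMap L₂ x)) := fun x => by
        rw [h₃, krausMap_comp K L₂, krausMap_comp L₁]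
      refine ⟨L₃, ⟨?_, fun y hy => ?_⟩, funext fun x => h₃' _⟩
      · rw [h₃', h₂.1, hK, h₁.1]
      · rw [h₃', h₂.2 y hy, h₁.2 y hy])
  have hE : ∀ x, krausMap (fun p : (Fin n × Fin n) × Fin n × Fin n => K p.1 * L' p.2) x =
      krausMap L' (krausMap K x) := fun x => (krausMap_comp _ _ _).symm
  refine ⟨L', fun x => ?_⟩
  rw [← hE]
  refine krausMap_eq_self_of_idempotent ?_ (fun x => ?_) hgen (fun y hy => ?_) x
  · rw [hE, hK, hL'.1]
  · simp only [hE]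
    exact congrFun hidem x
  · rw [hE, hL'.2 y hy]

end Compactness

/-! ### Extension of completely positive maps from operator systems -/

section Extension

open scoped Matrix

/-- Every Hermitian matrix becomes positive semidefinite after adding a large multiple of `1`. -/
theorem Matrix.IsHermitian.exists_posSemidef_smul_one_add {m : Type*} [Fintype m] [DecidableEq m]
    {H : Matrix m m ℂ} (hH : H.IsHermitian) :
    ∃ c : ℝ, 0 ≤ c ∧ ((c : ℂ) • (1 : Matrix m m ℂ) + H).PosSemidef := by
  open scoped Matrix.Norms.L2Operator MatrixOrder in
  have h := IsSelfAdjoint.neg_algebraMap_norm_le_self (a := H) hH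
  refine ⟨_, norm_nonneg H, ?_⟩
  rw [← sub_nonneg, Matrix.nonneg_iff_posSemidef] at h
  have he : (((‖H‖ : ℝ) : ℂ) • (1 : Matrix m m ℂ)) = algebraMap ℝ (Matrix m m ℂ) ‖H‖ := by
    rw [Algebra.algebraMap_eq_smul_one, Complex.coe_smul]
  rwa [he, add_comm, ← sub_neg_eq_add]

/-- Krein's extension theorem for matrices: a functional that is positive on a unital self-adjoint
subspace extends to a positive functional on all matrices. -/
theorem exists_posSemidef_extension {m : Type*} [Fintype m] [DecidableEq m]
    (D : Submodule ℂ (Matrix m m ℂ)) (hone : (1 : Matrix m m ℂ) ∈ D)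
    (hstar : ∀ B ∈ D, Bᴴ ∈ D) (s : Matrix m m ℂ →ₗ[ℂ] ℂ)
    (hs : ∀ B ∈ D, B.PosSemidef → 0 ≤ s B) :
    ∃ G : Matrix m m ℂ →ₗ[ℂ] ℂ, (∀ B ∈ D, G B = s B) ∧ (∀ B, G Bᴴ = star (G B)) ∧
      ∀ B : Matrix m m ℂ, B.PosSemidef → 0 ≤ G B := by
  have him : ∀ H ∈ D, H.IsHermitian → (s H).im = 0 := by
    intro H hHD hH
    obtain ⟨c, hc, hpos⟩ := hH.exists_posSemidef_smul_one_add
    have hc1 : ((c : ℂ) • (1 : Matrix m m ℂ)) ∈ D := D.smul_mem _ hone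
    have h1 := (Complex.nonneg_iff.1 (hs _ (D.add_mem hc1 hHD) hpos)).2
    have h2 := (Complex.nonneg_iff.1 (hs _ hc1
      (Matrix.PosSemidef.one.smul (Complex.zero_le_real.2 hc)))).2
    rw [map_add, Complex.add_im, ← h2, zero_add] at h1
    exact h1.symm
  have hre : ∀ B ∈ D, (s Bᴴ).re = (s B).re := by
    intro B hB
    have h := him (Complex.I • (B - Bᴴ)) (D.smul_mem _ (D.sub_mem hB (hstar B hB))) (by
      rw [Matrix.IsHermitian, Matrix.conjTranspose_smul, Matrix.conjTranspose_sub,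
        Matrix.conjTranspose_conjTranspose, Complex.star_def, Complex.conj_I]
      module)
    simp only [map_smul, map_sub, smul_eq_mul, Complex.mul_im, Complex.I_re, Complex.I_im,
      Complex.sub_re, zero_mul, one_mul, zero_add] at h
    linarith
  -- The real extension theorem is applied to the cone of matrices with positive Hermitian part.
  let P : PointedCone ℝ (Matrix m m ℂ) :=
    { carrier := {B | (B + Bᴴ).PosSemidef}
      add_mem' := by
        intro A B hA hB
        simp only [Set.mem_ofPred_eq, Matrix.conjTranspose_add] at *
        convert hA.add hB using 1
        abel
      zero_mem' := by simp [Matrix.PosSemidef.zero]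
      smul_mem' := by
        intro c B hB
        simp only [Set.mem_ofPred_eq] at *
        have h := hB.smul (a := ((c : ℝ) : ℂ)) (Complex.zero_le_real.2 c.2)
        have he : c • B = ((c : ℝ) : ℂ) • B := (Complex.coe_smul _ _).symm
        rwa [he, Matrix.conjTranspose_smul, Complex.star_def, Complex.conj_ofReal, ← smul_add] }
  have hP : ∀ B, B ∈ P ↔ (B + Bᴴ).PosSemidef := fun B => Iff.rfl
  let f : Matrix m m ℂ →ₗ.[ℝ] ℝ := ⟨D.restrictScalars ℝ,
    (Complex.reLm ∘ₗ s.restrictScalars ℝ).domRestrict (D.restrictScalars ℝ)⟩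
  obtain ⟨g, hgf, hgP⟩ := riesz_extension P f
    (by
      rintro ⟨B, hB⟩ hBP
      have hBD : B ∈ D := hB
      have h := (Complex.nonneg_iff.1 (hs _ (D.add_mem hBD (hstar B hBD)) hBP)).1
      rw [map_add, Complex.add_re, hre B hBD] at h
      change 0 ≤ (s B).re
      linarith)
    (by
      intro y
      obtain ⟨c, hc, hpos⟩ :=
        (Matrix.isHermitian_add_transpose_self y).exists_posSemidef_smul_one_add
      refine ⟨⟨((c : ℂ) • (1 : Matrix m m ℂ)), D.smul_mem _ hone⟩, ?_⟩
      rw [hP]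
      convert hpos.add (Matrix.PosSemidef.one.smul (Complex.zero_le_real.2 hc)) using 1
      simp only [Matrix.conjTranspose_add, Matrix.conjTranspose_smul, Matrix.conjTranspose_one,
        Complex.star_def, Complex.conj_ofReal]
      abel)
  -- Skew-Hermitian matrices lie in the cone together with their negatives.
  have hskew : ∀ B : Matrix m m ℂ, Bᴴ = -B → g B = 0 := by
    intro B hB
    refine le_antisymm ?_ (hgP B (by
      rw [← SetLike.mem_coe, SetLike.mem_coe, hP, hB, add_neg_cancel]
      exact Matrix.PosSemidef.zero))
    have := hgP (-B) (by
      rw [← SetLike.mem_coe, SetLike.mem_coe, hP, Matrix.conjTranspose_neg, hB, add_neg_cancel]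
      exact Matrix.PosSemidef.zero)
    rw [map_neg] at this
    linarith
  have hherm : ∀ B : Matrix m m ℂ, g Bᴴ = g B := by
    intro B
    rw [← sub_eq_zero, ← map_sub]
    exact hskew _ (by simp)
  have hI : ∀ B : Matrix m m ℂ, g (Complex.I • Bᴴ) = - g (Complex.I • B) := by
    intro B
    rw [← hherm, ← map_neg]
    congr 1
    simp
  have hG : ∀ B : Matrix m m ℂ, (Module.Dual.extendRCLike (𝕜 := ℂ) g : Matrix m m ℂ →ₗ[ℂ] ℂ) B =
      g B - Complex.I * g (Complex.I • B) := by
    intro B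
    rw [Module.Dual.extendRCLike_apply]
    rfl
  refine ⟨Module.Dual.extendRCLike (𝕜 := ℂ) g, fun B hB => ?_, fun B => ?_, fun B hB => ?_⟩
  · have h1 : g B = (s B).re := hgf ⟨B, hB⟩
    have h2 : g (Complex.I • B) = (s (Complex.I • B)).re :=
      hgf ⟨Complex.I • B, D.smul_mem _ hB⟩
    rw [hG, h1, h2, map_smul]
    apply Complex.ext <;> simp
  · rw [hG, hG, hherm, hI]
    apply Complex.ext <;> simp
  · have hB' : g (Complex.I • B) = 0 := by
      have := hI B
      rw [hB.1.eq] at this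
      linarith
    rw [hG, hB', Complex.ofReal_zero, mul_zero, sub_zero, Complex.zero_le_real]
    refine hgP B ?_
    rw [hP, hB.1.eq]
    exact hB.add hB

/-- The `(i, j)` block of an element of `M_n(M_n)`. -/
def matrixBlock {n : ℕ} (i j : Fin n) :
    Matrix (Fin n × Fin n) (Fin n × Fin n) ℂ →ₗ[ℂ] Matrix (Fin n) (Fin n) ℂ where
  toFun B := Matrix.of fun a b => B (i, a) (j, b)
  map_add' _ _ := rfl
  map_smul' _ _ := rfl

theorem matrixBlock_apply {n : ℕ} (i j : Fin n) (B : Matrix (Fin n × Fin n) (Fin n × Fin n) ℂ)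
    (a b : Fin n) : matrixBlock i j B a b = B (i, a) (j, b) := rfl

/-- Arveson's extension theorem in Kraus form: a completely positive map between operator systems
in `M_n` is the restriction of a Kraus map of `M_n`. -/
theorem OperatorSystem.IsCompletelyPositive.exists_krausMap {n : ℕ} {V W : OperatorSystem n}
    {φ : V.carrier →ₗ[ℂ] W.carrier} (hφ : OperatorSystem.IsCompletelyPositive φ) :
    ∃ K : Fin n × Fin n → Matrix (Fin n) (Fin n) ℂ,
      ∀ x : V.carrier, (φ x : Matrix (Fin n) (Fin n) ℂ) = krausMap K x := by
  obtain ⟨φ', hφ'⟩ := LinearMap.exists_extend (W.carrier.subtype ∘ₗ φ)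
  have hφ'' : ∀ x : V.carrier, φ' x = φ x := fun x => LinearMap.congr_fun hφ' x
  let D : Submodule ℂ (Matrix (Fin n × Fin n) (Fin n × Fin n) ℂ) :=
    ⨅ i, ⨅ j, V.carrier.comap (matrixBlock i j)
  have hD : ∀ B, B ∈ D ↔ ∀ i j, matrixBlock i j B ∈ V.carrier := fun B => by
    simp [D, Submodule.mem_iInf]
  -- Complete positivity is tested against the vector `∑ i, e_i ⊗ e_i`.
  let s : Matrix (Fin n × Fin n) (Fin n × Fin n) ℂ →ₗ[ℂ] ℂ :=
    ∑ i, ∑ j, Matrix.entryLinearMap ℂ ℂ i j ∘ₗ φ' ∘ₗ matrixBlock i j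
  have hs : ∀ B, s B = ∑ i, ∑ j, φ' (matrixBlock i j B) i j := fun B => by
    simp [s, LinearMap.sum_apply]
  obtain ⟨G, hGD, hGstar, hGpos⟩ := exists_posSemidef_extension D
    (by
      rw [hD]
      intro i j
      by_cases hij : i = j
      · subst hij
        convert V.one_mem using 1
        ext a b
        simp [matrixBlock_apply, Matrix.one_apply]
      · convert V.carrier.zero_mem using 1
        ext a b
        simp [matrixBlock_apply, hij])
    (by
      intro B hB
      rw [hD] at hB ⊢
      intro i j
      exact V.star_mem _ (hB j i))
    s
    (by
      intro B hB hpos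
      rw [hD] at hB
      let A : Matrix (Fin n) (Fin n) V.carrier := Matrix.of fun i j => ⟨matrixBlock i j B, hB i j⟩
      have hA : W.MatrixPositive (A.map φ) := hφ n A hpos
      have h := hA.dotProduct_mulVec_nonneg (fun p => if p.1 = p.2 then 1 else 0)
      rw [hs]
      convert h using 1
      simp only [dotProduct, Matrix.mulVec, Fintype.sum_prod_type]
      simp [A, ← hφ'' ⟨_, hB _ _⟩])
  let C : Matrix (Fin n × Fin n) (Fin n × Fin n) ℂ :=
    Matrix.of fun p q => G (Matrix.single p q 1)
  have hC : C.PosSemidef := by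
    refine Matrix.PosSemidef.of_dotProduct_mulVec_nonneg ?_ fun v => ?_
    · ext p q
      simp only [C, Matrix.conjTranspose_apply, Matrix.of_apply]
      rw [← hGstar, Matrix.conjTranspose_single, star_one]
    · have h := hGpos _ (Matrix.posSemidef_vecMulVec_star_self v)
      convert h using 1
      conv_rhs => rw [Matrix.matrix_eq_sum_single (Matrix.vecMulVec (star v) v)]
      simp only [map_sum, dotProduct, Matrix.mulVec, Finset.mul_sum]
      refine Finset.sum_congr rfl fun p _ => Finset.sum_congr rfl fun q _ => ?_
      have : Matrix.single p q (Matrix.vecMulVec (star v) v p q) =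
          (star v p * v q) • Matrix.single p q (1 : ℂ) := by
        rw [Matrix.smul_single, smul_eq_mul, mul_one, Matrix.vecMulVec_apply]
      rw [this, map_smul, smul_eq_mul]
      simp only [C, Matrix.of_apply]
      ring
  obtain ⟨K, hK⟩ := exists_choiOfKraus_eq hC
  refine ⟨K, fun x => ?_⟩
  ext i j
  rw [krausMap_apply_apply, hK]
  -- The matrix with block `x` at `(i, j)`.
  let B : Matrix (Fin n × Fin n) (Fin n × Fin n) ℂ :=
    Matrix.of fun p q => if p.1 = i ∧ q.1 = j then (x : Matrix (Fin n) (Fin n) ℂ) p.2 q.2 else 0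
  have hblock : ∀ k l, matrixBlock k l B =
      if k = i ∧ l = j then (x : Matrix (Fin n) (Fin n) ℂ) else 0 := by
    intro k l
    ext a b
    by_cases h : k = i ∧ l = j <;> simp [matrixBlock_apply, B, h]
  have hBD : B ∈ D := by
    rw [hD]
    intro k l
    rw [hblock]
    split_ifs
    exacts [x.2, V.carrier.zero_mem]
  have hBsum : B = ∑ a, ∑ b, (x : Matrix (Fin n) (Fin n) ℂ) a b •
      Matrix.single (i, a) (j, b) (1 : ℂ) := by
    ext ⟨k, a⟩ ⟨l, b⟩
    simp only [B, Matrix.of_apply, Matrix.sum_apply, Matrix.smul_apply, Matrix.single_apply,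
      Prod.mk.injEq, smul_eq_mul, mul_ite, mul_one, mul_zero]
    rw [Finset.sum_eq_single a, Finset.sum_eq_single b]
    · simp [eq_comm]
    · intro c _ hc; simp [hc]
    · simp
    · intro c _ hc; simp [hc]
    · simp
  have h1 : s B = (φ x : Matrix (Fin n) (Fin n) ℂ) i j := by
    rw [hs, Finset.sum_eq_single i, Finset.sum_eq_single j]
    · rw [hblock, if_pos ⟨rfl, rfl⟩, hφ'']
    · intro l _ hl; simp [hblock, hl]
    · simp
    · intro l _ hl; simp [hblock, hl]
    · simp
  rw [← h1, ← hGD B hBD, hBsum]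
  simp only [map_sum, map_smul, smul_eq_mul, C, Matrix.of_apply]

end Extension

/-! ### Words in two matrices -/

section Words

open scoped Kronecker

variable {n : ℕ} {R : Type*} [CommRing R]

/-- The matrix whose row `(i, j)` lists the entries of the word `A ^ i * B * A ^ j`. -/
def wordMatrix (A B : Matrix (Fin n) (Fin n) R) : Matrix (Fin n × Fin n) (Fin n × Fin n) R :=
  Matrix.of fun p q => (A ^ (p.1 : ℕ) * B * A ^ (p.2 : ℕ)) q.1 q.2

theorem wordMatrix_map {S : Type*} [CommRing S] (f : R →+* S) (A B : Matrix (Fin n) (Fin n) R) :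
    f.mapMatrix (wordMatrix A B) = wordMatrix (f.mapMatrix A) (f.mapMatrix B) := by
  ext p q
  simp only [wordMatrix, ← map_pow, ← map_mul]
  rfl

theorem adjoin_eq_top_of_det_wordMatrix_ne_zero {K : Type*} [Field K]
    {A B : Matrix (Fin n) (Fin n) K} (h : (wordMatrix A B).det ≠ 0)
    {V : Set (Matrix (Fin n) (Fin n) K)} (hA : A ∈ Algebra.adjoin K V)
    (hB : B ∈ Algebra.adjoin K V) : Algebra.adjoin K V = ⊤ := by
  refine eq_top_iff.2 fun M _ => ?_
  set c : Fin n × Fin n → K := Matrix.vecMul (fun q => M q.1 q.2) (wordMatrix A B)⁻¹ with hc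
  have hM : M = ∑ p, c p • (A ^ (p.1 : ℕ) * B * A ^ (p.2 : ℕ)) := by
    have h1 : Matrix.vecMul c (wordMatrix A B) = fun q => M q.1 q.2 := by
      rw [hc, Matrix.vecMul_vecMul, Matrix.nonsing_inv_mul _ (isUnit_iff_ne_zero.2 h),
        Matrix.vecMul_one]
    ext a b
    rw [show M a b = _ from (congrFun h1 (a, b)).symm, Matrix.sum_apply]
    rfl
  rw [hM]
  exact Subalgebra.sum_mem _ fun p _ => Subalgebra.smul_mem _
    (mul_mem (mul_mem (pow_mem hA _) hB) (pow_mem hA _)) _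

/-- For diagonal `A` the matrix of words is, up to column scaling, a Kronecker square of a
Vandermonde matrix. -/
theorem det_wordMatrix_diagonal_ne_zero [IsDomain R] {l : Fin n → R} (hl : Function.Injective l)
    {B : Matrix (Fin n) (Fin n) R} (hB : ∀ i j, B i j ≠ 0) :
    (wordMatrix (Matrix.diagonal l) B).det ≠ 0 := by
  have hW : wordMatrix (Matrix.diagonal l) B =
      ((Matrix.vandermonde l).transpose ⊗ₖ (Matrix.vandermonde l).transpose) *
        Matrix.diagonal fun q => B q.1 q.2 := by
    ext p q
    rw [Matrix.mul_diagonal]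
    simp only [wordMatrix, Matrix.of_apply, Matrix.diagonal_pow, Matrix.mul_diagonal,
      Matrix.diagonal_mul, Matrix.kroneckerMap_apply, Matrix.transpose_apply,
      Matrix.vandermonde_apply, Pi.pow_apply]
    ring
  rw [hW, Matrix.det_mul, Matrix.det_kronecker, Matrix.det_transpose, Matrix.det_diagonal]
  have hv := Matrix.det_vandermonde_ne_zero_iff.2 hl
  exact mul_ne_zero (mul_ne_zero (pow_ne_zero _ hv) (pow_ne_zero _ hv))
    (Finset.prod_ne_zero_iff.2 fun q _ => hB _ _)

theorem finite_setOf_det_wordMatrix_add_smul_eq_zero {A B : Matrix (Fin n) (Fin n) ℂ}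
    (h : (wordMatrix A B).det ≠ 0) (A' B' : Matrix (Fin n) (Fin n) ℂ) :
    {t : ℝ | (wordMatrix (A + t • A') (B + t • B')).det = 0}.Finite := by
  -- The determinant along the line is a polynomial in `t`: the words are formed over `ℂ[X]`.
  let line : Matrix (Fin n) (Fin n) ℂ → Matrix (Fin n) (Fin n) ℂ →
      Matrix (Fin n) (Fin n) (Polynomial ℂ) := fun M N =>
    Matrix.of fun i j => Polynomial.C (M i j) + Polynomial.X * Polynomial.C (N i j)
  have hline : ∀ (t : ℝ) M N, (Polynomial.evalRingHom (t : ℂ)).mapMatrix (line M N) =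
      M + t • N := by
    intro t M N
    ext i j
    simp only [line, RingHom.mapMatrix_apply, Matrix.map_apply, Matrix.of_apply,
      Polynomial.coe_evalRingHom, Polynomial.eval_add, Polynomial.eval_mul, Polynomial.eval_C,
      Polynomial.eval_X, Matrix.add_apply, Matrix.smul_apply, Complex.real_smul]
  let p : Polynomial ℂ := (wordMatrix (line A A') (line B B')).det
  have hp : ∀ t : ℝ, p.eval (t : ℂ) = (wordMatrix (A + t • A') (B + t • B')).det := by
    intro t
    rw [← hline, ← hline, ← wordMatrix_map, ← RingHom.map_det]
    rfl
  have hp0 : p ≠ 0 := by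
    intro h0
    have := hp 0
    rw [h0, Polynomial.eval_zero, zero_smul, zero_smul, add_zero, add_zero] at this
    exact h this.symm
  refine Set.Finite.subset ((p.rootSet_finite ℂ).preimage
    (f := ((↑) : ℝ → ℂ)) Complex.ofReal_injective.injOn) fun t ht => ?_
  rw [Set.mem_preimage, Polynomial.mem_rootSet]
  refine ⟨hp0, ?_⟩
  rw [Polynomial.coe_aeval_eq_eval, hp]
  exact ht

theorem continuous_det_wordMatrix :
    Continuous fun p : Matrix (Fin n) (Fin n) ℂ × Matrix (Fin n) (Fin n) ℂ =>
      (wordMatrix p.1 p.2).det := by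
  refine Continuous.matrix_det (continuous_matrix fun i j => ?_)
  simp only [wordMatrix, Matrix.of_apply]
  exact Continuous.matrix_elem (by fun_prop) _ _

end Words

/-! ### Null sets and products of absolutely continuous measures -/

section NullSets

/-- A measurable set that meets every line through `x₀` in a null set is null. By Fubini's
theorem almost every dilate of the set about `x₀` is null, and dilating rescales the measure. -/
theorem measure_eq_zero_of_forall_line {E : Type*} [NormedAddCommGroup E] [NormedSpace ℝ E]
    [MeasurableSpace E] [BorelSpace E] [FiniteDimensional ℝ E] (μ : Measure E)
    [μ.IsAddHaarMeasure] {Z : Set E} (hZ : MeasurableSet Z) (x₀ : E)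
    (h : ∀ v : E, volume {t : ℝ | x₀ + t • v ∈ Z} = 0) : μ Z = 0 := by
  have hmeas : MeasurableSet {p : E × ℝ | ¬ x₀ + p.2 • p.1 ∈ Z} :=
    (hZ.preimage (by fun_prop : Measurable fun p : E × ℝ => x₀ + p.2 • p.1)).compl
  have hae : ∀ᵐ t : ℝ, ∀ᵐ v ∂μ, ¬ x₀ + t • v ∈ Z := by
    rw [← Measure.ae_ae_comm hmeas]
    refine Filter.Eventually.of_forall fun v => ?_
    rw [ae_iff]
    simpa using h v
  obtain ⟨t, ht, ht0⟩ := (hae.and (Measure.ae_ne volume (0 : ℝ))).exists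
  rw [ae_iff] at ht
  simp only [not_not] at ht
  have h1 : {v | x₀ + t • v ∈ Z} = (t • ·) ⁻¹' ((x₀ + ·) ⁻¹' Z) := rfl
  rw [h1, Measure.addHaar_preimage_smul μ ht0, measure_preimage_add, mul_eq_zero] at ht
  refine ht.resolve_left ?_
  rw [ENNReal.ofReal_eq_zero, not_le]
  positivity

theorem MeasureTheory.Measure.AbsolutelyContinuous.pi_const {α : Type*} [MeasurableSpace α]
    {μ ν : Measure α} [SigmaFinite μ] [SigmaFinite ν] (h : μ ≪ ν) (m : ℕ) :
    Measure.pi (fun _ : Fin m => μ) ≪ Measure.pi (fun _ : Fin m => ν) := by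
  induction m with
  | zero =>
    rw [Measure.pi_of_empty, Measure.pi_of_empty]
  | succ m ih =>
    rw [← (measurePreserving_piFinSuccAbove (fun _ : Fin (m + 1) => μ) 0).symm.map_eq,
      ← (measurePreserving_piFinSuccAbove (fun _ : Fin (m + 1) => ν) 0).symm.map_eq]
    exact (h.prod ih).map (MeasurableEquiv.measurable _)

end NullSets

/-! ### Two traceless GUE matrices generate `M_n` -/

section GUE

variable {n : ℕ}

instance instBorelSpaceComplexMatrix (n : ℕ) : BorelSpace (Matrix (Fin n) (Fin n) ℂ) :=
  inferInstanceAs (BorelSpace (Fin n → Fin n → ℂ))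

instance instSecondCountableTopologyComplexMatrix (n : ℕ) :
    SecondCountableTopology (Matrix (Fin n) (Fin n) ℂ) :=
  inferInstanceAs (SecondCountableTopology (Fin n → Fin n → ℂ))

/-- The traceless Hermitian matrix with real coordinates `g`, as a real-linear map. -/
noncomputable def tracelessHermitian (n : ℕ) :
    (Fin n → Fin n → ℝ) →ₗ[ℝ] Matrix (Fin n) (Fin n) ℂ where
  toFun g := tracelessPart (hermitianOfReal g)
  map_add' g h := by
    have hadd : (hermitianOfReal (g + h)).1 = (hermitianOfReal g).1 + (hermitianOfReal h).1 := by
      ext i j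
      simp only [hermitianOfReal, Matrix.of_apply, Matrix.add_apply, Pi.add_apply]
      split_ifs <;> push_cast <;> ring
    simp only [tracelessPart, hadd, Matrix.trace_add, add_div, add_smul]
    abel
  map_smul' c g := by
    have hsmul : (hermitianOfReal (c • g)).1 = (c : ℂ) • (hermitianOfReal g).1 := by
      ext i j
      simp only [hermitianOfReal, Matrix.of_apply, Matrix.smul_apply, Pi.smul_apply, smul_eq_mul]
      split_ifs <;> push_cast <;> ring
    simp only [tracelessPart, hsmul, Matrix.trace_smul, RingHom.id_apply, Complex.coe_smul]
    rw [smul_sub, smul_div_assoc, smul_assoc]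

theorem tracelessHermitian_apply (g : Fin n → Fin n → ℝ) :
    tracelessHermitian n g = tracelessPart (hermitianOfReal g) := rfl

theorem exists_det_wordMatrix_tracelessHermitian_ne_zero (hn : 2 ≤ n) :
    ∃ g h : Fin n → Fin n → ℝ,
      (wordMatrix (tracelessHermitian n g) (tracelessHermitian n h)).det ≠ 0 := by
  have hs : (√2 : ℂ) ≠ 0 := by
    norm_num
  -- The first matrix is `diag (0, …, n - 1)`; the second one has diagonal `(1, 0, …, 0)`, so that
  -- after removing the trace no diagonal entry vanishes, and off-diagonal entries `(1 ± 𝐢) / 2`.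
  let g : Fin n → Fin n → ℝ := fun i j => if i = j then √2 * i else 0
  let h : Fin n → Fin n → ℝ := fun i j => if i = j then (if (i : ℕ) = 0 then √2 else 0) else 1
  have hg : (hermitianOfReal g).1 = Matrix.diagonal fun i : Fin n => ((i : ℕ) : ℂ) := by
    ext i j
    by_cases hij : i = j
    · subst hij
      simp [hermitianOfReal, g]
    · simp [hermitianOfReal, g, hij, Ne.symm hij]
  have hh : ∀ i, (hermitianOfReal h).1 i i = if (i : ℕ) = 0 then 1 else 0 := by
    intro i
    by_cases hi : (i : ℕ) = 0 <;> simp [hermitianOfReal, h, hi]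
  have htr : (hermitianOfReal h).1.trace = 1 := by
    have h0 : 0 < n := by omega
    simp only [Matrix.trace, Matrix.diag_apply, hh]
    rw [Finset.sum_eq_single ⟨0, h0⟩]
    · simp
    · intro b _ hb
      rw [if_neg fun h => hb (Fin.ext h)]
    · simp
  refine ⟨g, h, ?_⟩
  have hg' : tracelessHermitian n g = Matrix.diagonal fun i : Fin n =>
      ((i : ℕ) : ℂ) - (hermitianOfReal g).1.trace / n := by
    rw [tracelessHermitian_apply]
    simp only [tracelessPart]
    conv_lhs => rw [hg, Matrix.smul_one_eq_diagonal, Matrix.diagonal_sub]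
    rw [hg]
  rw [hg']
  refine det_wordMatrix_diagonal_ne_zero (fun i j hij => ?_) fun i j => ?_
  · exact Fin.ext (by simpa using hij)
  · rw [tracelessHermitian_apply]
    simp only [tracelessPart, htr, Matrix.sub_apply, Matrix.smul_apply]
    have hn0 : (n : ℂ) ≠ 0 := by
      have : n ≠ 0 := by omega
      exact_mod_cast this
    rcases lt_trichotomy i j with hij | hij | hij
    · rw [Matrix.one_apply_ne hij.ne]
      simp only [hermitianOfReal, Matrix.of_apply, h, hij.ne, hij.ne', hij, if_true, if_false]
      intro h0
      have := congrArg Complex.re h0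
      simp at this
    · subst hij
      rw [hh, Matrix.one_apply_eq, smul_eq_mul, mul_one, sub_ne_zero]
      split_ifs
      · intro h1
        rw [eq_div_iff hn0, one_mul] at h1
        have : n = 1 := by exact_mod_cast h1
        omega
      · exact (one_div_ne_zero hn0).symm
    · rw [Matrix.one_apply_ne hij.ne']
      simp only [hermitianOfReal, Matrix.of_apply, h, hij.ne, hij.ne', hij.not_gt, if_false]
      intro h0
      have := congrArg Complex.re h0
      simp at this

theorem measurable_det_wordMatrix_coe : Measurable
    fun p : selfAdjoint (Matrix (Fin n) (Fin n) ℂ) × selfAdjoint (Matrix (Fin n) (Fin n) ℂ) =>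
      (wordMatrix (p.1 : Matrix (Fin n) (Fin n) ℂ) (p.2 : Matrix (Fin n) (Fin n) ℂ)).det := by
  have h : Measurable fun p : selfAdjoint (Matrix (Fin n) (Fin n) ℂ) ×
      selfAdjoint (Matrix (Fin n) (Fin n) ℂ) =>
        ((p.1 : Matrix (Fin n) (Fin n) ℂ), (p.2 : Matrix (Fin n) (Fin n) ℂ)) :=
    (measurable_subtype_coe.comp measurable_fst).prodMk (measurable_subtype_coe.comp measurable_snd)
  have hcomp := continuous_det_wordMatrix.measurable.comp h
  rw [Function.comp_def] at hcomp
  exact hcomp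

theorem volume_setOf_det_wordMatrix_tracelessHermitian_eq_zero (hn : 2 ≤ n) :
    volume {p : (Fin n → Fin n → ℝ) × (Fin n → Fin n → ℝ) |
      (wordMatrix (tracelessHermitian n p.1) (tracelessHermitian n p.2)).det = 0} = 0 := by
  obtain ⟨g, h, hgh⟩ := exists_det_wordMatrix_tracelessHermitian_ne_zero hn
  have hmeas := (measurable_tracelessPart n).comp (measurable_hermitianOfReal n)
  have hhaar : (volume : Measure (Fin n → Fin n → ℝ)).IsAddHaarMeasure :=
    Measure.pi.isAddHaarMeasure _
  have hhaar' : (volume : Measure ((Fin n → Fin n → ℝ) × (Fin n → Fin n → ℝ))).IsAddHaarMeasure :=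
    Measure.prod.instIsAddHaarMeasure _ _
  refine measure_eq_zero_of_forall_line volume ?_ (g, h) fun v => ?_
  · have hcomp := measurable_det_wordMatrix_coe.comp (hmeas.prodMap hmeas)
    rw [Function.comp_def] at hcomp
    exact measurableSet_eq_fun hcomp measurable_const
  · refine Set.Finite.measure_zero ((finite_setOf_det_wordMatrix_add_smul_eq_zero hgh
      (tracelessHermitian n v.1) (tracelessHermitian n v.2)).subset fun t ht => ?_) _
    have ht' : (wordMatrix (tracelessHermitian n (g + t • v.1))
      (tracelessHermitian n (h + t • v.2))).det = 0 := ht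
    rw [map_add, map_add, map_smul, map_smul] at ht'
    exact ht'

/-- The words in two independent traceless GUE matrices almost surely span `M_n`. -/
theorem ae_det_wordMatrix_tracelessGUE_ne_zero (hn : 2 ≤ n) :
    ∀ᵐ p ∂(tracelessGUE n).prod (tracelessGUE n),
      (wordMatrix (p.1 : Matrix (Fin n) (Fin n) ℂ) p.2).det ≠ 0 := by
  set γ : Measure (Fin n → Fin n → ℝ) :=
    Measure.pi fun _ : Fin n => Measure.pi fun _ : Fin n => gaussianReal 0 1
  have hmeas := (measurable_tracelessPart n).comp (measurable_hermitianOfReal n)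
  have hlaw : tracelessGUE n = γ.map (tracelessPart ∘ hermitianOfReal) :=
    Measure.map_map (measurable_tracelessPart n) (measurable_hermitianOfReal n)
  have hγ : γ ≪ volume :=
    ((gaussianReal_absolutelyContinuous 0 one_ne_zero).pi_const n).pi_const n
  rw [hlaw, Measure.map_prod_map _ _ hmeas hmeas]
  rw [ae_iff]
  simp only [ne_eq, not_not]
  rw [Measure.map_apply (hmeas.prodMap hmeas)
    (measurableSet_eq_fun measurable_det_wordMatrix_coe measurable_const)]
  refine hγ.prod hγ ?_
  exact volume_setOf_det_wordMatrix_tracelessHermitian_eq_zero hn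

end GUE

/-! ### Automorphisms of operator systems that generate `M_n` -/

section Automorphisms

variable {n : ℕ} [NeZero n]

/-- If the operator system `V` generates `M_n`, then every unital complete order automorphism of
`V` is the restriction of a conjugation by a unitary. -/
theorem OperatorSystem.IsUnitalCompleteOrderIso.exists_unitary {V : OperatorSystem n}
    (hgen : Algebra.adjoin ℂ (V.carrier : Set (Matrix (Fin n) (Fin n) ℂ)) = ⊤)
    {φ : V.carrier ≃ₗ[ℂ] V.carrier} (hφ : OperatorSystem.IsUnitalCompleteOrderIso φ) :
    ∃ U : unitary (Matrix (Fin n) (Fin n) ℂ), ∀ x : V.carrier,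
      Unitary.conjStarAlgAut ℂ (Matrix (Fin n) (Fin n) ℂ) U x = φ x := by
  obtain ⟨K, hK⟩ := hφ.completelyPositive.exists_krausMap
  obtain ⟨L, hL⟩ := hφ.completelyPositive_symm.exists_krausMap
  have hK1 : krausMap K 1 = 1 :=
    (hK V.unit).symm.trans (congrArg Subtype.val hφ.map_unit)
  have hL1 : krausMap L 1 = 1 := (hL V.unit).symm.trans (congrArg Subtype.val
    (show φ.symm V.unit = V.unit by rw [LinearEquiv.symm_apply_eq, hφ.map_unit]))
  obtain ⟨L', hL'⟩ := exists_krausMap_leftInverse hK1 hL1 hgen fun y hy => by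
    rw [← hK ⟨y, hy⟩, ← hL]
    exact congrArg Subtype.val (φ.symm_apply_apply ⟨y, hy⟩)
  obtain ⟨U, hU, hKU⟩ := exists_unitary_of_krausMap_leftInverse hK1 hL'
  refine ⟨star ⟨U, hU⟩, fun x => ?_⟩
  rw [Unitary.conjStarAlgAut_star_apply, ← hKU, ← hK]
  rfl

theorem OperatorSystem.unitalCompleteOrderAut_eq_bot {V : OperatorSystem n}
    (hgen : Algebra.adjoin ℂ (V.carrier : Set (Matrix (Fin n) (Fin n) ℂ)) = ⊤)
    (htriv : V.quantumGraphAut = ⊥) : V.unitalCompleteOrderAut = ⊥ := by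
  refine (Subgroup.eq_bot_iff_forall _).2 fun φ hφ => ?_
  obtain ⟨U, hU⟩ := OperatorSystem.IsUnitalCompleteOrderIso.exists_unitary hgen hφ
  have hmem : Unitary.conjStarAlgAut ℂ (Matrix (Fin n) (Fin n) ℂ) U ∈ V.quantumGraphAut := by
    refine Set.Subset.antisymm ?_ fun y hy => ?_
    · rintro _ ⟨x, hx, rfl⟩
      rw [hU ⟨x, hx⟩]
      exact (φ ⟨x, hx⟩).2
    · exact ⟨φ.symm ⟨y, hy⟩, (φ.symm ⟨y, hy⟩).2, by rw [hU, φ.apply_symm_apply]⟩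
  rw [htriv, Subgroup.mem_bot] at hmem
  refine LinearEquiv.ext fun x => Subtype.ext ?_
  rw [← hU, hmem]
  rfl

end Automorphisms

theorem proposition1 (n d : ℕ) (hn : 3 ≤ n) (hd : 2 ≤ d) (hd' : d ≤ n ^ 2 - 3)
    {Ω : Type*} [MeasurableSpace Ω] (P : Measure Ω) [IsProbabilityMeasure P]
    (X : Fin d → Ω → selfAdjoint (Matrix (Fin n) (Fin n) ℂ))
    (hlaw : ∀ i, HasLaw (X i) (tracelessGUE n) P) (hindep : iIndepFun X P)
    (htriv : ∀ᵐ ω ∂P, (OperatorSystem.ofTuple fun i => X i ω).quantumGraphAut = ⊥) :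
    ∀ᵐ ω ∂P, (OperatorSystem.ofTuple fun i => X i ω).unitalCompleteOrderAut = ⊥ := by
  have : NeZero n := ⟨by omega⟩
  let i₀ : Fin d := ⟨0, by omega⟩
  let i₁ : Fin d := ⟨1, by omega⟩
  have h01 : i₀ ≠ i₁ := by simp [i₀, i₁]
  have hmap := (hindep.indepFun h01).map_prod_eq_prod_map_map (hlaw i₀).aemeasurable
    (hlaw i₁).aemeasurable
  rw [(hlaw i₀).map_eq, (hlaw i₁).map_eq] at hmap
  have hdet := ae_of_ae_map ((hlaw i₀).aemeasurable.prodMk (hlaw i₁).aemeasurable)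
    (hmap ▸ ae_det_wordMatrix_tracelessGUE_ne_zero (n := n) (by omega))
  filter_upwards [htriv, hdet] with ω hω hω'
  have hmem : ∀ i, (X i ω : Matrix (Fin n) (Fin n) ℂ) ∈ Algebra.adjoin ℂ
      ((OperatorSystem.ofTuple fun i => X i ω).carrier : Set (Matrix (Fin n) (Fin n) ℂ)) :=
    fun i => Algebra.subset_adjoin (Submodule.subset_span (Set.mem_insert_of_mem _ ⟨i, rfl⟩))
  exact OperatorSystem.unitalCompleteOrderAut_eq_bot
    (adjoin_eq_top_of_det_wordMatrix_ne_zero hω' (hmem i₀) (hmem i₁)) hω
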